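/- An indexed grammar over a finite alphabet $\Sigma$ (in the sense of Hopcroft and Ullman) consists of a finite set $N$ of nonterminals, a finite set $F$ of indices, a sentence symbol $S \in N$, and a finite set of productions, each of one of the forms $A \to \alpha$, $A \to Bf$, $Af \to \alpha$ with $A, B \in N$, $f \in F$, $\alpha \in (N \cup \Sigma)^*$. Sentential forms are the elements of $(NF^* \cup \Sigma)^*$. For sentential forms $\beta, \gamma$ and $\delta \in F^*$, a derivation step replaces $\beta A\delta\gamma$ by $\beta(\alpha\cdot\delta)\gamma$ if $A \to \alpha$ is a production, $\beta A\delta\gamma$ by $\beta Bf\delta\gamma$ if $A \to Bf$ is a production, and $\beta Af\delta\gamma$ by $\beta(\alpha\cdot\delta)\gamma$ if $Af \to \alpha$ is a production, where $\alpha\cdot\delta$ is obtained from $\alpha$ by appending the index string $\delta$ to each nonterminal in $\alpha$ and leaving the terminals unchanged. The language generated by the grammar is the set of all words in $\Sigma^*$ derivable from $S$ in finitely many steps, and a language over $\Sigma$ is indexed if it is generated by some indexed grammar over $\Sigma$. Let $\Sigma$ be a finite alphabet and let $a, b \in \Sigma$ be distinct letters. Then the language $\{(ab^n)^n \mid n \geq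 1\}$ over $\Sigma$ is not indexed. -/

import Mathlib

/-- A production of an indexed grammar with terminals `T`, nonterminals `N` and indices `I`. -/
inductive IndexedRule (T N I : Type*) where
  /-- The production `A → α`, with `α` a word of nonterminals and terminals. -/
  | rewrite (A : N) (α : List (Symbol T N))
  /-- The production `A → B f`, which pushes the index `f`. -/
  | push (A B : N) (f : I)
  /-- The production `A f → α`, which consumes the index `f`. -/
  | pop (A : N) (f : I) (α : List (Symbol T N))

/-- Indexed grammars over the terminal alphabet `T`, in the form of Hopcroft and Ullman:
finitely many nonterminals, indices and productions. -/
structure IndexedGrammar (T : Type*) where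
  /-- Nonterminals. -/
  NT : Type
  /-- Indices. -/
  Idx : Type
  /-- There are finitely many nonterminals. -/
  finite_NT : Finite NT
  /-- There are finitely many indices. -/
  finite_Idx : Finite Idx
  /-- The sentence symbol. -/
  initial : NT
  /-- The productions. -/
  rules : Finset (IndexedRule T NT Idx)

namespace IndexedGrammar

/-- Sentential forms: words whose letters are terminals or nonterminals carrying an index string.
The head of the list of indices is the index next to the nonterminal (the top of the stack). -/
abbrev SententialForm {T : Type*} (g : IndexedGrammar T) : Type _ :=
  List (Symbol T (g.NT × List g.Idx))

/-- Attach the index string `δ` to a symbol: nonterminals receive `δ`, terminals are unchanged. -/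
def attach {T N I : Type*} (δ : List I) : Symbol T N → Symbol T (N × List I)
  | .terminal t => .terminal t
  | .nonterminal A => .nonterminal (A, δ)

/-- One derivation step. -/
inductive Produces {T : Type*} (g : IndexedGrammar T) :
    g.SententialForm → g.SententialForm → Prop
  | rewrite {A : g.NT} {α : List (Symbol T g.NT)} (h : .rewrite A α ∈ g.rules)
      (β γ : g.SententialForm) (δ : List g.Idx) :
      Produces g (β ++ [.nonterminal (A, δ)] ++ γ) (β ++ α.map (attach δ) ++ γ)
  | push {A B : g.NT} {f : g.Idx} (h : .push A B f ∈ g.rules)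
      (β γ : g.SententialForm) (δ : List g.Idx) :
      Produces g (β ++ [.nonterminal (A, δ)] ++ γ) (β ++ [.nonterminal (B, f :: δ)] ++ γ)
  | pop {A : g.NT} {f : g.Idx} {α : List (Symbol T g.NT)} (h : .pop A f α ∈ g.rules)
      (β γ : g.SententialForm) (δ : List g.Idx) :
      Produces g (β ++ [.nonterminal (A, f :: δ)] ++ γ) (β ++ α.map (attach δ) ++ γ)

/-- Derivability in finitely many (possibly zero) steps. -/
def Derives {T : Type*} (g : IndexedGrammar T) : g.SententialForm → g.SententialForm → Prop :=
  Relation.ReflTransGen g.Produces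

/-- The language generated by an indexed grammar: the terminal words derivable from the sentence
symbol with the empty index string. -/
def language {T : Type*} (g : IndexedGrammar T) : Language T :=
  {w | g.Derives [.nonterminal (g.initial, [])] (w.map .terminal)}

end IndexedGrammar

/-- A language is indexed if some indexed grammar generates it. -/
def Language.IsIndexed {T : Type*} (L : Language T) : Prop :=
  ∃ g : IndexedGrammar T, g.language = L

/-- The word `(a bⁿ)ⁿ`. -/
def abPowWord {T : Type*} (a b : T) (n : ℕ) : List T :=
  (List.replicate n (a :: List.replicate n b)).flatten

/-- The language `{(a bⁿ)ⁿ | n ≥ 1}`. -/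
def abPowLanguage {T : Type*} (a b : T) : Language T :=
  {w | ∃ n : ℕ, 1 ≤ n ∧ w = abPowWord a b n}

/-! Call a language rigid if two of its words sharing a factor with two `a`s are equal. The words
(ab^n)^n form a rigid language, because the gap between consecutive `a`s determines n, and they
contain arbitrarily many `a`s. So it suffices to bound the number of `a`s in the words of a rigid
indexed language (`exists_count_le_of_isRigid`).

The bound comes from an exchange. An expansion of A that leaves the inherited indices alone can be
replaced by one of length at most C with the same nonterminals (`exists_bound_expansion`), each
deriving a word it already derived before. If a factor with two `a`s survives, rigidity says that
the word has not changed; so parts with at most M `a`s give at most C * M in total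
(`count_le_of_expands`). When two `a`s lie on one side of a subtree, this yields a cut of it into
parts with at most K `a`s (`Gen.exists_small_cut`).

`Gen.count_le` descends the derivation tree. If some part of an expansion has two `a`s, induction
leaves at least three `a`s outside each part, so all parts have small cuts and the exchange applies.
Otherwise every part has at most one `a`: a rewriting is then short, and a pushed index is absorbed
into the unspecified index string, its pops becoming leaves with at most K `a`s. -/

namespace IndexedGrammar

/-! ### Words whose nonterminals carry the terminal words they derive -/

section Annotated

variable {T X Y : Type*}

/-- Forget the terminal word attached to a nonterminal letter. -/
def eraseLetter : Symbol T (X × List T) → Symbol T X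
  | .terminal t => .terminal t
  | .nonterminal p => .nonterminal p.1

/-- The terminal word carried by a letter. -/
def letterYield : Symbol T (X × List T) → List T
  | .terminal t => [t]
  | .nonterminal p => p.2

/-- The word underlying an annotated word. -/
def skeleton (l : List (Symbol T (X × List T))) : List (Symbol T X) :=
  l.map eraseLetter

/-- The terminal word obtained by replacing each nonterminal by its annotation. -/
def wordYield (l : List (Symbol T (X × List T))) : List T :=
  l.flatMap letterYield

@[simp] theorem wordYield_nil : wordYield ([] : List (Symbol T (X × List T))) = [] := rfl

@[simp] theorem wordYield_cons (s : Symbol T (X × List T)) (l : List (Symbol T (X × List T))) :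
    wordYield (s :: l) = letterYield s ++ wordYield l := by
  simp [wordYield]

@[simp] theorem wordYield_append (l m : List (Symbol T (X × List T))) :
    wordYield (l ++ m) = wordYield l ++ wordYield m := by
  simp [wordYield]

/-- Replace each annotated nonterminal by an annotated word. -/
def substLetter (F : X → List T → List (Symbol T (Y × List T))) :
    Symbol T (X × List T) → List (Symbol T (Y × List T))
  | .terminal t => [.terminal t]
  | .nonterminal p => F p.1 p.2

theorem wordYield_flatMap_substLetter (F : X → List T → List (Symbol T (Y × List T)))
    (l : List (Symbol T (X × List T)))
    (h : ∀ B v, .nonterminal (B, v) ∈ l → wordYield (F B v) = v) :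
    wordYield (l.flatMap (substLetter F)) = wordYield l := by
  induction l with
  | nil => rfl
  | cons s l ih =>
    rw [List.flatMap_cons, wordYield_append, wordYield_cons,
      ih fun B v hB => h B v (List.mem_cons_of_mem _ hB)]
    congr 1
    rcases s with t | ⟨B, v⟩
    · simp [substLetter, letterYield]
    · exact h B v (by simp)

theorem mem_flatMap_substLetter {F : X → List T → List (Symbol T (Y × List T))}
    {l : List (Symbol T (X × List T))} {E : Y} {e : List T}
    (h : Symbol.nonterminal (E, e) ∈ l.flatMap (substLetter F)) :
    ∃ B v, .nonterminal (B, v) ∈ l ∧ .nonterminal (E, e) ∈ F B v := by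
  obtain ⟨s, hs, hE⟩ := List.mem_flatMap.1 h
  rcases s with t | ⟨B, v⟩
  · simp [substLetter] at hE
  · exact ⟨B, v, hs, hE⟩

theorem mem_flatMap_substLetter_of_mem {F : X → List T → List (Symbol T (Y × List T))}
    {l : List (Symbol T (X × List T))} {B : X} {v : List T} {s : Symbol T (Y × List T)}
    (h : Symbol.nonterminal (B, v) ∈ l) (hs : s ∈ F B v) :
    s ∈ l.flatMap (substLetter F) :=
  List.mem_flatMap.2 ⟨_, h, hs⟩

theorem infix_wordYield_of_mem {l : List (Symbol T (X × List T))} {B : X} {v : List T}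
    (h : Symbol.nonterminal (B, v) ∈ l) : v <:+: wordYield l := by
  obtain ⟨l₁, l₂, rfl⟩ := List.append_of_mem h
  exact ⟨wordYield l₁, wordYield l₂, by simp [letterYield]⟩

theorem count_wordYield_le [DecidableEq T] (a : T) {M : ℕ} (hM : 1 ≤ M)
    (l : List (Symbol T (X × List T)))
    (h : ∀ B v, .nonterminal (B, v) ∈ l → v.count a ≤ M) :
    (wordYield l).count a ≤ l.length * M := by
  induction l with
  | nil => simp
  | cons s l ih =>
    have h₁ := ih fun B v hB => h B v (List.mem_cons_of_mem _ hB)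
    have h₂ : (letterYield s).count a ≤ M := by
      rcases s with t | ⟨B, v⟩
      · exact (List.count_le_length (a := a) (l := [t])).trans (by simpa using hM)
      · exact h B v (by simp)
    rw [wordYield_cons, List.count_append, List.length_cons, Nat.succ_mul]
    omega

end Annotated

variable {T : Type*} {g : IndexedGrammar T}

/-! ### Closure properties of derivations -/

theorem Derives.context {p q : g.SententialForm} (h : g.Derives p q) (x y : g.SententialForm) :
    g.Derives (x ++ p ++ y) (x ++ q ++ y) := by
  refine Relation.ReflTransGen.lift (p := g.Produces) (fun s => x ++ s ++ y) ?_ _ _ h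
  rintro _ _ (⟨h, β, γ, δ⟩ | ⟨h, β, γ, δ⟩ | ⟨h, β, γ, δ⟩) <;> rw [Function.onFun]
  · simpa using Produces.rewrite h (x ++ β) (γ ++ y) δ
  · simpa using Produces.push h (x ++ β) (γ ++ y) δ
  · simpa using Produces.pop h (x ++ β) (γ ++ y) δ

theorem Derives.append {p q p' q' : g.SententialForm} (h : g.Derives p q)
    (h' : g.Derives p' q') : g.Derives (p ++ p') (q ++ q') := by
  have h₁ := h.context [] p'
  have h₂ := h'.context q []
  simp only [List.nil_append, List.append_nil] at h₁ h₂
  exact h₁.trans h₂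

theorem derives_flatMap {X : Type*} (l : List X) (φ ψ : X → g.SententialForm)
    (h : ∀ s ∈ l, g.Derives (φ s) (ψ s)) : g.Derives (l.flatMap φ) (l.flatMap ψ) := by
  induction l with
  | nil => exact .refl
  | cons s l ih =>
    simp only [List.flatMap_cons]
    exact (h s (by simp)).append (ih fun s hs => h s (List.mem_cons_of_mem _ hs))

/-- Put an index string below the index string of a letter. -/
def raise {T N I : Type*} (γ : List I) : Symbol T (N × List I) → Symbol T (N × List I)
  | .terminal t => .terminal t
  | .nonterminal p => .nonterminal (p.1, p.2 ++ γ)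

@[simp] theorem raise_nonterminal {T N I : Type*} (γ δ : List I) (A : N) :
    raise γ (.nonterminal (A, δ) : Symbol T (N × List I)) = .nonterminal (A, δ ++ γ) := rfl

theorem raise_comp_attach {T N I : Type*} (γ δ : List I) :
    (raise γ ∘ attach δ : Symbol T N → Symbol T (N × List I)) = attach (δ ++ γ) := by
  funext s
  cases s <;> rfl

theorem Derives.raise {p q : g.SententialForm} (h : g.Derives p q) (γ : List g.Idx) :
    g.Derives (p.map (raise γ)) (q.map (raise γ)) := by
  refine Relation.ReflTransGen.lift (p := g.Produces)
    (fun s : g.SententialForm => s.map (IndexedGrammar.raise γ)) ?_ _ _ h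
  rintro _ _ (⟨h, β, β', δ⟩ | ⟨h, β, β', δ⟩ | ⟨h, β, β', δ⟩) <;> rw [Function.onFun]
  · simpa [raise_comp_attach] using
      Produces.rewrite h (β.map (IndexedGrammar.raise γ)) (β'.map (IndexedGrammar.raise γ)) (δ ++ γ)
  · simpa [raise_comp_attach] using
      Produces.push h (β.map (IndexedGrammar.raise γ)) (β'.map (IndexedGrammar.raise γ)) (δ ++ γ)
  · simpa [raise_comp_attach] using
      Produces.pop h (β.map (IndexedGrammar.raise γ)) (β'.map (IndexedGrammar.raise γ)) (δ ++ γ)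

theorem Derives.raise_attach {A : g.NT} {σ : List g.Idx} {z : List (Symbol T g.NT)}
    (h : g.Derives [.nonterminal (A, σ)] (z.map (attach []))) (γ : List g.Idx) :
    g.Derives [.nonterminal (A, σ ++ γ)] (z.map (attach γ)) := by
  simpa [raise_comp_attach] using h.raise γ

theorem derives_of_rewrite {A : g.NT} {α : List (Symbol T g.NT)} (h : .rewrite A α ∈ g.rules)
    (δ : List g.Idx) : g.Derives [.nonterminal (A, δ)] (α.map (attach δ)) :=
  .single (by simpa using Produces.rewrite h [] [] δ)

theorem derives_of_push {A B : g.NT} {f : g.Idx} (h : .push A B f ∈ g.rules)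
    (δ : List g.Idx) : g.Derives [.nonterminal (A, δ)] [.nonterminal (B, f :: δ)] :=
  .single (by simpa using Produces.push h [] [] δ)

theorem derives_of_pop {A : g.NT} {f : g.Idx} {α : List (Symbol T g.NT)}
    (h : .pop A f α ∈ g.rules) (δ : List g.Idx) :
    g.Derives [.nonterminal (A, f :: δ)] (α.map (attach δ)) :=
  .single (by simpa using Produces.pop h [] [] δ)

theorem derives_substLetter (σ τ : List g.Idx)
    (F : g.NT → List T → List (Symbol T (g.NT × List T)))
    (l : List (Symbol T (g.NT × List T)))
    (h : ∀ B v, .nonterminal (B, v) ∈ l →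
      g.Derives [.nonterminal (B, σ)] ((skeleton (F B v)).map (attach τ))) :
    g.Derives ((skeleton l).map (attach σ))
      ((skeleton (l.flatMap (substLetter F))).map (attach τ)) := by
  have := derives_flatMap l (fun s => [attach σ (eraseLetter s)])
    (fun s => (skeleton (substLetter F s)).map (attach τ)) ?_
  · simpa [skeleton, List.map_flatMap, Function.comp_def, ← List.map_eq_flatMap] using this
  · rintro (t | ⟨B, v⟩) hs
    · exact .refl
    · exact h B v hs

/-- The terminal word `v` is derivable from the nonterminal `A` carrying `γ`. -/
def Yields (g : IndexedGrammar T) (A : g.NT) (γ : List g.Idx) (v : List T) : Prop :=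
  g.Derives [.nonterminal (A, γ)] (v.map .terminal)

theorem derives_wordYield (γ : List g.Idx) (l : List (Symbol T (g.NT × List T)))
    (h : ∀ B v, .nonterminal (B, v) ∈ l → g.Yields B γ v) :
    g.Derives ((skeleton l).map (attach γ)) ((wordYield l).map .terminal) := by
  have := derives_flatMap l (fun s => [attach γ (eraseLetter s)])
    (fun s => (letterYield s).map .terminal) ?_
  · simpa [skeleton, wordYield, List.map_flatMap, Function.comp_def,
      ← List.map_eq_flatMap] using this
  · rintro (t | ⟨B, v⟩) hs
    · exact .refl
    · exact h B v hs

/-- The sentential form underlying `l` is derivable from `A` without touching the indices that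
`A` carries. -/
def Expands (g : IndexedGrammar T) (A : g.NT) (l : List (Symbol T (g.NT × List T))) : Prop :=
  g.Derives [.nonterminal (A, [])] ((skeleton l).map (attach []))

theorem Expands.yields {A : g.NT} {l : List (Symbol T (g.NT × List T))} (h : g.Expands A l)
    {γ : List g.Idx} (hl : ∀ B v, .nonterminal (B, v) ∈ l → g.Yields B γ v) :
    g.Yields A γ (wordYield l) :=
  (Derives.raise_attach h γ).trans (derives_wordYield γ l hl)

theorem Expands.subst {A : g.NT} {l : List (Symbol T (g.NT × List T))} (h : g.Expands A l)
    {F : g.NT → List T → List (Symbol T (g.NT × List T))}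
    (hF : ∀ B v, .nonterminal (B, v) ∈ l → g.Expands B (F B v)) :
    g.Expands A (l.flatMap (substLetter F)) :=
  Relation.ReflTransGen.trans h (derives_substLetter [] [] F l hF)

/-! ### Derivation trees over an unspecified index string, and their cuts -/

/-- `g.Gen Q h A σ u`: a derivation tree of height at most `h` derives `u` from `A` carrying `σ`
above an unspecified index string; a nonterminal exposing the unspecified string may be replaced
by a terminal word as allowed by `Q`. -/
inductive Gen (g : IndexedGrammar T) (Q : g.NT → List T → Prop) :
    ℕ → g.NT → List g.Idx → List T → Prop
  | leaf {h : ℕ} {A : g.NT} {u : List T} (hQ : Q A u) : Gen g Q (h + 1) A [] u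
  | rewrite {h : ℕ} {A : g.NT} {σ : List g.Idx} (l : List (Symbol T (g.NT × List T)))
      (hr : .rewrite A (skeleton l) ∈ g.rules)
      (hl : ∀ B v, Symbol.nonterminal (B, v) ∈ l → Gen g Q h B σ v) :
      Gen g Q (h + 1) A σ (wordYield l)
  | push {h : ℕ} {A B : g.NT} {f : g.Idx} {σ : List g.Idx} {u : List T}
      (hr : .push A B f ∈ g.rules) (hu : Gen g Q h B (f :: σ) u) : Gen g Q (h + 1) A σ u
  | pop {h : ℕ} {A : g.NT} {f : g.Idx} {σ : List g.Idx} (l : List (Symbol T (g.NT × List T)))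
      (hr : .pop A f (skeleton l) ∈ g.rules)
      (hl : ∀ B v, Symbol.nonterminal (B, v) ∈ l → Gen g Q h B σ v) :
      Gen g Q (h + 1) A (f :: σ) (wordYield l)

theorem Gen.mono {Q Q' : g.NT → List T → Prop} (hQ : ∀ B v, Q B v → Q' B v) {h : ℕ} {A : g.NT}
    {σ : List g.Idx} {u : List T} (H : g.Gen Q h A σ u) {k : ℕ} (hk : h ≤ k) :
    g.Gen Q' k A σ u := by
  induction H generalizing k with
  | leaf h =>
    cases k with
    | zero => omega
    | succ k => exact .leaf (hQ _ _ h)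
  | rewrite l hr _ ih =>
    cases k with
    | zero => omega
    | succ k => exact .rewrite l hr fun B v hB => ih B v hB (by omega)
  | push hr _ ih =>
    cases k with
    | zero => omega
    | succ k => exact .push hr (ih (by omega))
  | pop l hr _ ih =>
    cases k with
    | zero => omega
    | succ k => exact .pop l hr fun B v hB => ih B v hB (by omega)

/-- A tree can be cut along the nonterminals that expose the unspecified index string. -/
theorem Gen.exists_cut {Q : g.NT → List T → Prop} {h : ℕ} {A : g.NT} {σ : List g.Idx}
    {u : List T} (H : g.Gen Q h A σ u) :
    ∃ m : List (Symbol T (g.NT × List T)),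
      g.Derives [.nonterminal (A, σ)] ((skeleton m).map (attach [])) ∧ wordYield m = u ∧
      (∀ B v, .nonterminal (B, v) ∈ m → Q B v) ∧
      g.Gen (fun B v => .nonterminal (B, v) ∈ m) h A σ u := by
  -- The tree is returned with membership in `m` as its leaf condition, so that later facts about
  -- the cut can be used at the leaves.
  induction H with
  | @leaf h A u hQ =>
    exact ⟨[.nonterminal (A, u)], .refl, by simp [letterYield], by simp; exact hQ,
      .leaf (by simp)⟩
  | @rewrite h A σ l hr hl ih =>
    choose! F hF using ih
    refine ⟨l.flatMap (substLetter F), ?_, ?_, ?_, ?_⟩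
    · exact (derives_of_rewrite hr σ).trans
        (derives_substLetter σ [] F l fun B v hB => (hF B v hB).1)
    · exact wordYield_flatMap_substLetter F l fun B v hB => (hF B v hB).2.1
    · intro B v hB
      obtain ⟨D, d, hD, hB⟩ := mem_flatMap_substLetter hB
      exact (hF D d hD).2.2.1 B v hB
    · exact .rewrite l hr fun B v hB => (hF B v hB).2.2.2.mono
        (fun _ _ hE => mem_flatMap_substLetter_of_mem hB hE) le_rfl
  | @push h A B f σ u hr hu ih =>
    obtain ⟨m, h₁, h₂, h₃, h₄⟩ := ih
    exact ⟨m, (derives_of_push hr σ).trans h₁, h₂, h₃, .push hr h₄⟩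
  | @pop h A f σ l hr hl ih =>
    choose! F hF using ih
    refine ⟨l.flatMap (substLetter F), ?_, ?_, ?_, ?_⟩
    · exact (derives_of_pop hr σ).trans
        (derives_substLetter σ [] F l fun B v hB => (hF B v hB).1)
    · exact wordYield_flatMap_substLetter F l fun B v hB => (hF B v hB).2.1
    · intro B v hB
      obtain ⟨D, d, hD, hB⟩ := mem_flatMap_substLetter hB
      exact (hF D d hD).2.2.1 B v hB
    · exact .pop l hr fun B v hB => (hF B v hB).2.2.2.mono
        (fun _ _ hE => mem_flatMap_substLetter_of_mem hB hE) le_rfl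

theorem Gen.yields {Q : g.NT → List T → Prop} {h : ℕ} {A : g.NT} {u : List T}
    (H : g.Gen Q h A [] u) {γ : List g.Idx} (hQ : ∀ B v, Q B v → g.Yields B γ v) :
    g.Yields A γ u := by
  obtain ⟨m, h₁, rfl, h₃, -⟩ := H.exists_cut
  exact Expands.yields h₁ fun B v hB => hQ B v (h₃ B v hB)

/-- The words obtained by first consuming `f` and then deriving in height at most `h`. -/
def PopGen (g : IndexedGrammar T) (Q : g.NT → List T → Prop) (h : ℕ) (f : g.Idx) (A : g.NT)
    (v : List T) : Prop :=
  ∃ l : List (Symbol T (g.NT × List T)), .pop A f (skeleton l) ∈ g.rules ∧ wordYield l = v ∧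
    ∀ B v, .nonterminal (B, v) ∈ l → g.Gen Q h B [] v

/-- The last index of the known string may be regarded as part of the unspecified string. -/
theorem Gen.forget_last {Q : g.NT → List T → Prop} {k h : ℕ} {A : g.NT} {σ τ : List g.Idx}
    {f : g.Idx} {u : List T} (H : g.Gen Q h A τ u) (hτ : τ = σ ++ [f]) (hk : h ≤ k) :
    g.Gen (g.PopGen Q k f) h A σ u := by
  induction H generalizing σ with
  | leaf => simp at hτ
  | rewrite l hr _ ih => exact .rewrite l hr fun B v hB => ih B v hB hτ (by omega)
  | push hr _ ih => exact .push hr (ih (by simp [hτ]) (by omega))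
  | pop l hr hl ih =>
    cases σ with
    | nil =>
      simp only [List.nil_append, List.cons.injEq] at hτ
      obtain ⟨rfl, rfl⟩ := hτ
      -- Consuming the last known index now counts as exposing the unspecified string.
      exact .leaf ⟨l, hr, rfl, fun B v hB => (hl B v hB).mono (fun _ _ h => h) (by omega)⟩
    | cons f' σ =>
      simp only [List.cons_append, List.cons.injEq] at hτ
      obtain ⟨rfl, rfl⟩ := hτ
      exact .pop l hr fun B v hB => ih B v hB rfl (by omega)

/-- A tree that pushes an index at its root splits at the nonterminals to which all of the index
strings pushed have been consumed again. -/
theorem Gen.exists_split_of_push {Q : g.NT → List T → Prop} {h : ℕ} {A B : g.NT} {f : g.Idx}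
    {u : List T} (hr : .push A B f ∈ g.rules) (H : g.Gen Q h B [f] u) :
    ∃ l : List (Symbol T (g.NT × List T)), g.Expands A l ∧ wordYield l = u ∧
      (∀ D v, .nonterminal (D, v) ∈ l → g.Gen Q h D [] v) ∧
      g.Gen (fun D v => ∃ m : List (Symbol T (g.NT × List T)), .pop D f (skeleton m) ∈ g.rules ∧
        wordYield m = v ∧ (∀ E e, .nonterminal (E, e) ∈ m → g.Gen Q h E [] e) ∧
        ∀ s ∈ m, s ∈ l) h B [] u := by
  obtain ⟨m, h₁, h₂, h₃, h₄⟩ := (H.forget_last (σ := []) rfl le_rfl).exists_cut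
  unfold PopGen at h₃
  choose! F hF using h₃
  refine ⟨m.flatMap (substLetter F), ?_, ?_, ?_, ?_⟩
  -- Push `f`, derive the cut with `f` kept underneath, then pop `f` from every nonterminal of the
  -- cut.
  · exact ((derives_of_push hr []).trans (Derives.raise_attach h₁ [f])).trans
      (derives_substLetter [f] [] F m fun D v hD => derives_of_pop (hF D v hD).1 [])
  · rw [wordYield_flatMap_substLetter F m fun D v hD => (hF D v hD).2.1, h₂]
  · intro D v hD
    obtain ⟨E, e, hE, hD⟩ := mem_flatMap_substLetter hD
    exact (hF E e hE).2.2 D v hD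
  · exact h₄.mono (fun D v hD => ⟨F D v, (hF D v hD).1, (hF D v hD).2.1, (hF D v hD).2.2,
      fun s hs => mem_flatMap_substLetter_of_mem hD hs⟩) le_rfl

/-- This drives the inductions on height: a push is followed until its index has been popped, so
that the parts again carry no known index. -/
theorem Gen.exists_split {Q : g.NT → List T → Prop} {h : ℕ} {A : g.NT} {u : List T}
    (H : g.Gen Q (h + 1) A [] u) :
    Q A u ∨ ∃ l : List (Symbol T (g.NT × List T)), g.Expands A l ∧ wordYield l = u ∧
      ∀ D v, .nonterminal (D, v) ∈ l → g.Gen Q h D [] v := by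
  cases H with
  | leaf hQ => exact .inl hQ
  | rewrite l hr hl => exact .inr ⟨l, derives_of_rewrite hr [], rfl, hl⟩
  | push hr hu =>
    obtain ⟨l, h₁, h₂, h₃, -⟩ := hu.exists_split_of_push hr
    exact .inr ⟨l, h₁, h₂, h₃⟩

/-! ### From derivations to trees -/

/-- An annotation of `α.map (attach δ)` comes from an annotation of `α`. -/
theorem exists_annotation_of_attach {T N I : Type*} {δ : List I} {α : List (Symbol T N)}
    {m : List (Symbol T ((N × List I) × List T))} (hm : skeleton m = α.map (attach δ)) :
    ∃ l : List (Symbol T (N × List T)), skeleton l = α ∧ wordYield l = wordYield m ∧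
      ∀ B v, .nonterminal (B, v) ∈ l → .nonterminal ((B, δ), v) ∈ m := by
  induction α generalizing m with
  | nil =>
    obtain rfl : m = [] := by simpa [skeleton] using hm
    exact ⟨[], rfl, rfl, by simp⟩
  | cons s α ih =>
    obtain ⟨r, m, rfl, hr, hm⟩ := List.map_eq_cons_iff.1 hm
    obtain ⟨l, hl, hy, hmem⟩ := ih hm
    rcases r with t | ⟨⟨B, σ⟩, v⟩ <;> rcases s with t' | B' <;>
      simp only [eraseLetter, attach, Symbol.terminal.injEq, Symbol.nonterminal.injEq,
        Prod.mk.injEq, reduceCtorEq] at hr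
    · subst hr
      refine ⟨.terminal t :: l, by simp [skeleton, eraseLetter, ← hl],
        by simp [letterYield, hy], fun B v hB => ?_⟩
      simp only [List.mem_cons, reduceCtorEq, false_or] at hB ⊢
      exact hmem B v hB
    · obtain ⟨rfl, rfl⟩ := hr
      refine ⟨.nonterminal (B, v) :: l, by simp [skeleton, eraseLetter, ← hl],
        by simp [letterYield, hy], fun D d hD => ?_⟩
      simp only [List.mem_cons, Symbol.nonterminal.injEq, Prod.mk.injEq, and_true] at hD ⊢
      exact hD.imp id (hmem D d)

/-- Every derivation of a terminal word is described by trees. -/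
theorem Derives.exists_gen {s : g.SententialForm} {w : List T}
    (H : g.Derives s (w.map .terminal)) :
    ∃ h, ∃ m : List (Symbol T ((g.NT × List g.Idx) × List T)), skeleton m = s ∧
      wordYield m = w ∧
      ∀ A σ v, .nonterminal ((A, σ), v) ∈ m → g.Gen (fun _ _ => False) h A σ v := by
  -- One step undone: the trees of the letters produced are joined under a new root, and the height
  -- bound grows by one.
  have key : ∀ {A : g.NT} {τ δ : List g.Idx} {β γ : g.SententialForm}
      {α : List (Symbol T g.NT)},
      (∀ h (l : List (Symbol T (g.NT × List T))), skeleton l = α →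
        (∀ B v, .nonterminal (B, v) ∈ l → g.Gen (fun _ _ => False) h B δ v) →
        g.Gen (fun _ _ => False) (h + 1) A τ (wordYield l)) →
      (∃ h, ∃ m : List (Symbol T ((g.NT × List g.Idx) × List T)),
        skeleton m = β ++ α.map (attach δ) ++ γ ∧ wordYield m = w ∧
        ∀ A σ v, .nonterminal ((A, σ), v) ∈ m → g.Gen (fun _ _ => False) h A σ v) →
      ∃ h, ∃ m : List (Symbol T ((g.NT × List g.Idx) × List T)),
        skeleton m = β ++ [.nonterminal (A, τ)] ++ γ ∧ wordYield m = w ∧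
        ∀ A σ v, .nonterminal ((A, σ), v) ∈ m → g.Gen (fun _ _ => False) h A σ v := by
    rintro A τ δ β γ α hα ⟨h, m, hm, rfl, hG⟩
    obtain ⟨m', m₃, rfl, hm', rfl⟩ := List.map_eq_append_iff.1 hm
    obtain ⟨m₁, m₂, rfl, rfl, hm₂⟩ := List.map_eq_append_iff.1 hm'
    obtain ⟨l, hl, hy, hmem⟩ := exists_annotation_of_attach hm₂
    refine ⟨h + 1, m₁ ++ [.nonterminal ((A, τ), wordYield m₂)] ++ m₃, by
      simp [skeleton, eraseLetter], by simp [letterYield], fun D σ v hD => ?_⟩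
    simp only [List.append_assoc, List.mem_append, List.mem_cons, List.not_mem_nil, or_false,
      Symbol.nonterminal.injEq, Prod.mk.injEq] at hD
    rcases hD with hD | ⟨⟨rfl, rfl⟩, rfl⟩ | hD
    · exact (hG D σ v (by simp [hD])).mono (fun _ _ h => h) (by omega)
    · rw [← hy]
      exact hα h l hl fun B v hB => hG B δ v (by simp [hmem B v hB])
    · exact (hG D σ v (by simp [hD])).mono (fun _ _ h => h) (by omega)
  induction H using Relation.ReflTransGen.head_induction_on with
  | refl =>
    refine ⟨0, w.map .terminal, ?_, ?_, by simp⟩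
    · simp [skeleton, Function.comp_def, eraseLetter]
    · simp [wordYield, List.flatMap_map, letterYield]
  | head hp _ ih =>
    cases hp with
    | rewrite hr β γ δ => exact key (fun h l hl hG => .rewrite l (hl ▸ hr) hG) ih
    | @push A B f hr β γ δ =>
      -- A push is handled as a one-letter right-hand side that receives the longer index string.
      refine key (δ := f :: δ) (α := [.nonterminal B]) (fun h l hl hG => ?_) ih
      obtain ⟨s, l, rfl, hs, hl⟩ := List.map_eq_cons_iff.1 hl
      obtain rfl : l = [] := by simpa using hl
      rcases s with t | ⟨D, v⟩
      · simp [eraseLetter] at hs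
      · obtain rfl : D = B := by simpa [eraseLetter] using hs
        have := hG D v (by simp)
        simpa [letterYield] using Gen.push hr this
    | pop hr β γ δ => exact key (fun h l hl hG => .pop l (hl ▸ hr) hG) ih

/-! ### Uniform bounds from finiteness -/

/-- Index-free derivations can be shortened to bounded length, keeping the set of nonterminals
of the derived form. -/
theorem exists_bound_expansion (g : IndexedGrammar T) :
    ∃ C : ℕ, ∀ (A : g.NT) (z : List (Symbol T g.NT)),
      g.Derives [.nonterminal (A, [])] (z.map (attach [])) →
      ∃ z' : List (Symbol T g.NT), g.Derives [.nonterminal (A, [])] (z'.map (attach [])) ∧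
        z'.length ≤ C ∧ ∀ B, .nonterminal B ∈ z' ↔ .nonterminal B ∈ z := by
  have := g.finite_NT
  have h : ∀ p : g.NT × Set g.NT, ∃ C : ℕ, ∀ z : List (Symbol T g.NT),
      g.Derives [.nonterminal (p.1, [])] (z.map (attach [])) →
      {B | Symbol.nonterminal B ∈ z} = p.2 →
      ∃ z' : List (Symbol T g.NT), g.Derives [.nonterminal (p.1, [])] (z'.map (attach [])) ∧
        z'.length ≤ C ∧ {B | Symbol.nonterminal B ∈ z'} = p.2 := by
    intro p
    by_cases hp : ∃ z : List (Symbol T g.NT),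
      g.Derives [.nonterminal (p.1, [])] (z.map (attach [])) ∧
      {B | Symbol.nonterminal B ∈ z} = p.2
    · obtain ⟨z, hz, hU⟩ := hp
      -- One form represents all forms with the same root and the same set of nonterminals; there
      -- are finitely many such pairs.
      exact ⟨z.length, fun _ _ _ => ⟨z, hz, le_rfl, hU⟩⟩
    · exact ⟨0, fun z hz hU => (hp ⟨z, hz, hU⟩).elim⟩
  choose c hc using h
  obtain ⟨C, hC⟩ := Set.Finite.bddAbove (Set.finite_range c)
  refine ⟨C, fun A z hz => ?_⟩
  obtain ⟨z', h₁, h₂, h₃⟩ := hc (A, {B | Symbol.nonterminal B ∈ z}) z hz rfl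
  exact ⟨z', h₁, h₂.trans (hC ⟨_, rfl⟩), fun B => Set.ext_iff.1 h₃ B⟩

theorem exists_bound_rules (g : IndexedGrammar T) :
    ∃ c : ℕ, (∀ A α, .rewrite A α ∈ g.rules → α.length ≤ c) ∧
      ∀ A f α, .pop A f α ∈ g.rules → α.length ≤ c := by
  let len : IndexedRule T g.NT g.Idx → ℕ
    | .rewrite _ α => α.length
    | .push _ _ _ => 0
    | .pop _ _ α => α.length
  exact ⟨g.rules.sup len, fun A α h => Finset.le_sup (f := len) h,
    fun A f α h => Finset.le_sup (f := len) h⟩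

/-- Every word derivable from `A` carrying `γ` gives a word of the language when put between `x`
and `y`. -/
def IsContext (g : IndexedGrammar T) (γ : List g.Idx) (A : g.NT) (x y : List T) : Prop :=
  ∀ v, g.Yields A γ v → x ++ v ++ y ∈ g.language

/-- The siblings keep their words, so they join the context while `B` varies freely. -/
theorem IsContext.of_expands {γ : List g.Idx} {A B : g.NT} {x y v : List T}
    (hc : g.IsContext γ A x y) {l₁ l₂ : List (Symbol T (g.NT × List T))}
    (h : g.Expands A (l₁ ++ .nonterminal (B, v) :: l₂))
    (hl : ∀ D d, .nonterminal (D, d) ∈ l₁ ++ .nonterminal (B, v) :: l₂ → g.Yields D γ d) :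
    g.IsContext γ B (x ++ wordYield l₁) (wordYield l₂ ++ y) := by
  intro v' hv'
  have h' : g.Expands A (l₁ ++ .nonterminal (B, v') :: l₂) := by
    simpa [Expands, skeleton, eraseLetter] using h
  have := hc _ (h'.yields (γ := γ) fun D d hD => ?_)
  · simpa [letterYield] using this
  · simp only [List.mem_append, List.mem_cons, Symbol.nonterminal.injEq, Prod.mk.injEq] at hD hl
    rcases hD with hD | ⟨rfl, rfl⟩ | hD
    · exact hl D d (.inl hD)
    · exact hv'
    · exact hl D d (.inr (.inr hD))

/-! ### Bounding the number of `a`s in a rigid language -/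

section Rigid

variable [DecidableEq T] {a : T}

/-- Two words of `L` with a common factor that contains `a` twice are equal. -/
def IsRigid (a : T) (L : Language T) : Prop :=
  ∀ w ∈ L, ∀ w' ∈ L, ∀ s : List T, s <:+: w → s <:+: w' → 2 ≤ s.count a → w = w'

/-- In a rigid language, replacing an expansion by a bounded one bounds the number of `a`s. -/
theorem count_le_of_expands (hL : IsRigid a g.language) {C : ℕ}
    (hC : ∀ (A : g.NT) (z : List (Symbol T g.NT)),
      g.Derives [.nonterminal (A, [])] (z.map (attach [])) →
      ∃ z' : List (Symbol T g.NT), g.Derives [.nonterminal (A, [])] (z'.map (attach [])) ∧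
        z'.length ≤ C ∧ ∀ B, .nonterminal B ∈ z' ↔ .nonterminal B ∈ z)
    {γ : List g.Idx} {A : g.NT} {x y : List T} (hc : g.IsContext γ A x y)
    {l : List (Symbol T (g.NT × List T))} (hA : g.Expands A l) {M : ℕ} (hM : 1 ≤ M)
    (hl : ∀ B v, .nonterminal (B, v) ∈ l → g.Yields B γ v ∧ v.count a ≤ M)
    (h2 : 2 ≤ x.count a ∨ 2 ≤ y.count a ∨ ∃ B v, .nonterminal (B, v) ∈ l ∧ 2 ≤ v.count a) :
    (wordYield l).count a ≤ C * M := by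
  obtain ⟨z, hz, hzC, hzl⟩ := hC A (skeleton l) hA
  have hmem : ∀ B, .nonterminal B ∈ z ↔ ∃ v, .nonterminal (B, v) ∈ l := by
    intro B
    rw [hzl]
    constructor
    · intro hB
      obtain ⟨s, hs, hB⟩ := List.mem_map.1 hB
      rcases s with t | ⟨D, v⟩
      · simp [eraseLetter] at hB
      · obtain rfl : D = B := by simpa [eraseLetter] using hB
        exact ⟨v, hs⟩
    · rintro ⟨v, hv⟩
      exact List.mem_map.2 ⟨_, hv, rfl⟩
  obtain ⟨V, hV, hV2⟩ : ∃ V : g.NT → List T,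
      (∀ B, .nonterminal B ∈ z → .nonterminal (B, V B) ∈ l) ∧
      (2 ≤ x.count a ∨ 2 ≤ y.count a ∨
        ∃ B, .nonterminal B ∈ z ∧ 2 ≤ (V B).count a) := by
    have h₀ : ∀ B, .nonterminal B ∈ z → ∃ v, .nonterminal (B, v) ∈ l := fun B => (hmem B).1
    choose! V hV using h₀
    rcases h2 with h2 | h2 | ⟨B, v, hB, hv⟩
    · exact ⟨V, hV, .inl h2⟩
    · exact ⟨V, hV, .inr (.inl h2)⟩
    · classical
      -- A nonterminal may occur with several words; for `B` the one with two `a`s is selected, so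
      -- that it survives the exchange.
      refine ⟨Function.update V B v, fun D hD => ?_,
        .inr (.inr ⟨B, (hmem B).2 ⟨v, hB⟩, by simpa using hv⟩)⟩
      by_cases h : D = B
      · subst h
        simpa using hB
      · simpa [h] using hV D hD
  let ann : Symbol T g.NT → Symbol T (g.NT × List T)
    | .terminal t => .terminal t
    | .nonterminal B => .nonterminal (B, V B)
  have hsk : skeleton (z.map ann) = z := by
    rw [skeleton, List.map_map]
    refine (List.map_congr_left fun s _ => ?_).trans (List.map_id z)
    cases s <;> rfl
  have hann : ∀ B v, .nonterminal (B, v) ∈ z.map ann → .nonterminal (B, v) ∈ l := by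
    intro B v hB
    obtain ⟨s, hs, hB⟩ := List.mem_map.1 hB
    rcases s with t | D
    · simp [ann] at hB
    · obtain ⟨rfl, rfl⟩ : D = B ∧ V D = v := by simpa [ann] using hB
      exact hV D hs
  have hA' : g.Expands A (z.map ann) := by
    rw [Expands, hsk]
    exact hz
  have hw' := hc _ (hA'.yields (γ := γ) fun B v hB => (hl B v (hann B v hB)).1)
  have hw := hc _ (hA.yields (γ := γ) fun B v hB => (hl B v hB).1)
  have heq : x ++ wordYield l ++ y = x ++ wordYield (z.map ann) ++ y := by
    rcases hV2 with h2 | h2 | ⟨B, hB, h2⟩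
    · exact hL _ hw _ hw' x ⟨[], _, by simp; rfl⟩ ⟨[], _, by simp; rfl⟩ h2
    · exact hL _ hw _ hw' y ⟨x ++ wordYield l, [], by simp⟩
        ⟨x ++ wordYield (z.map ann), [], by simp⟩ h2
    · refine hL _ hw _ hw' (V B) ?_ ?_ h2
      · exact (infix_wordYield_of_mem (hV B hB)).trans ⟨x, y, rfl⟩
      · exact (infix_wordYield_of_mem (List.mem_map.2 ⟨_, hB, rfl⟩)).trans ⟨x, y, rfl⟩
  have heq' : wordYield l = wordYield (z.map ann) :=
    List.append_cancel_left (List.append_cancel_right heq)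
  rw [heq']
  refine (count_wordYield_le a hM _ fun B v hB => (hl B v (hann B v hB)).2).trans ?_
  simpa using Nat.mul_le_mul_right M hzC

/-- Cuts of the factors of an expansion combine to a cut of the whole. -/
theorem Expands.exists_refine {K : ℕ} {γ : List g.Idx} {A : g.NT}
    {l : List (Symbol T (g.NT × List T))} (hA : g.Expands A l)
    (hl : ∀ B v, .nonterminal (B, v) ∈ l → ∃ m : List (Symbol T (g.NT × List T)),
      g.Expands B m ∧ wordYield m = v ∧
      (∀ D d, .nonterminal (D, d) ∈ m → g.Yields D γ d ∧ d.count a ≤ K) ∧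
      (2 ≤ v.count a → ∃ D d, .nonterminal (D, d) ∈ m ∧ 2 ≤ d.count a))
    (h2 : ∃ B v, .nonterminal (B, v) ∈ l ∧ 2 ≤ v.count a) :
    ∃ m : List (Symbol T (g.NT × List T)), g.Expands A m ∧ wordYield m = wordYield l ∧
      (∀ D d, .nonterminal (D, d) ∈ m → g.Yields D γ d ∧ d.count a ≤ K) ∧
      ∃ D d, .nonterminal (D, d) ∈ m ∧ 2 ≤ d.count a := by
  choose! F hF using hl
  refine ⟨l.flatMap (substLetter F), hA.subst fun B v hB => (hF B v hB).1,
    wordYield_flatMap_substLetter F l fun B v hB => (hF B v hB).2.1, fun D d hD => ?_, ?_⟩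
  · obtain ⟨B, v, hB, hD⟩ := mem_flatMap_substLetter hD
    exact (hF B v hB).2.2.1 D d hD
  · obtain ⟨B, v, hB, hv⟩ := h2
    obtain ⟨D, d, hD, hd⟩ := (hF B v hB).2.2.2 hv
    exact ⟨D, d, mem_flatMap_substLetter_of_mem hB hD, hd⟩

/-- A tree that is not almost everything has a cut into parts with few `a`s, one of which
contains two `a`s if the whole does. -/
theorem Gen.exists_small_cut (hL : IsRigid a g.language) {C K : ℕ}
    (hC : ∀ (A : g.NT) (z : List (Symbol T g.NT)),
      g.Derives [.nonterminal (A, [])] (z.map (attach [])) →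
      ∃ z' : List (Symbol T g.NT), g.Derives [.nonterminal (A, [])] (z'.map (attach [])) ∧
        z'.length ≤ C ∧ ∀ B, .nonterminal B ∈ z' ↔ .nonterminal B ∈ z)
    (hCK : C ≤ K) {γ : List g.Idx} {Q : g.NT → List T → Prop}
    (hQ : ∀ B v, Q B v → g.Yields B γ v ∧ v.count a ≤ K) {h : ℕ} {A : g.NT} {u x y : List T}
    (H : g.Gen Q h A [] u) (hc : g.IsContext γ A x y)
    (h2 : 2 ≤ x.count a ∨ 2 ≤ y.count a) :
    ∃ m : List (Symbol T (g.NT × List T)), g.Expands A m ∧ wordYield m = u ∧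
      (∀ D d, .nonterminal (D, d) ∈ m → g.Yields D γ d ∧ d.count a ≤ K) ∧
      (2 ≤ u.count a → ∃ D d, .nonterminal (D, d) ∈ m ∧ 2 ≤ d.count a) := by
  induction h generalizing A u x y with
  | zero => cases H
  | succ h ih =>
    have hY := H.yields fun B v hB => (hQ B v hB).1
    by_cases hu : u.count a ≤ K
    -- A small word is its own cut.
    · refine ⟨[.nonterminal (A, u)], .refl, by simp [letterYield], fun D d hD => ?_,
        fun h => ⟨A, u, by simp, h⟩⟩
      obtain ⟨rfl, rfl⟩ : D = A ∧ d = u := by simpa using hD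
      exact ⟨hY, hu⟩
    · obtain hQA | ⟨l, hA, rfl, hl⟩ := H.exists_split
      · exact (hu (hQ A u hQA).2).elim
      have hly : ∀ B v, .nonterminal (B, v) ∈ l → g.Yields B γ v :=
        fun B v hB => (hl B v hB).yields fun B v hB => (hQ B v hB).1
      by_cases hl2 : ∃ B v, .nonterminal (B, v) ∈ l ∧ 2 ≤ v.count a
      · obtain ⟨m, h₁, h₂, h₃, h₄⟩ := hA.exists_refine (K := K) (γ := γ) (fun B v hB => by
          obtain ⟨l₁, l₂, rfl⟩ := List.append_of_mem hB
          refine ih (hl B v hB) (hc.of_expands hA hly) ?_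
          simp only [List.count_append]
          omega) hl2
        exact ⟨m, h₁, h₂, h₃, fun _ => h₄⟩
      · push Not at hl2
        refine (hu ?_).elim
        -- With at most one `a` per part, the exchange gives at most `C * 1 ≤ K`, against `hu`.
        have := count_le_of_expands hL hC hc hA le_rfl
          (fun B v hB => ⟨hly B v hB, Nat.le_of_lt_succ (hl2 B v hB)⟩) (by tauto)
        omega

/-- In a rigid language, trees with small cuts at the given index string cannot contain many
`a`s. -/
theorem Gen.count_le (hL : IsRigid a g.language) {C K : ℕ}
    (hC : ∀ (A : g.NT) (z : List (Symbol T g.NT)),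
      g.Derives [.nonterminal (A, [])] (z.map (attach [])) →
      ∃ z' : List (Symbol T g.NT), g.Derives [.nonterminal (A, [])] (z'.map (attach [])) ∧
        z'.length ≤ C ∧ ∀ B, .nonterminal B ∈ z' ↔ .nonterminal B ∈ z)
    (hCK : C ≤ K) (hK : 1 ≤ K)
    (hrw : ∀ A α, .rewrite A α ∈ g.rules → α.length ≤ K)
    (hpop : ∀ A f α, .pop A f α ∈ g.rules → α.length ≤ K)
    {w : List T} (hw : C * K + K + 2 < w.count a) {γ : List g.Idx} {Q : g.NT → List T → Prop}
    (hQ : ∀ B v, Q B v → g.Yields B γ v ∧ v.count a ≤ K) {h : ℕ} {A : g.NT} {u x y : List T}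
    (H : g.Gen Q h A [] u) (hc : g.IsContext γ A x y) (hxy : x ++ u ++ y = w) :
    u.count a ≤ C * K + K := by
  induction h generalizing γ Q A u x y with
  | zero => cases H
  | succ h ih =>
    by_cases h2 : 2 ≤ x.count a ∨ 2 ≤ y.count a
    · by_cases hu : 2 ≤ u.count a
      · obtain ⟨m, h₁, rfl, h₃, h₄⟩ := H.exists_small_cut hL hC hCK hQ hc h2
        exact (count_le_of_expands hL hC hc h₁ hK h₃ (.inr (.inr (h₄ hu)))).trans (by omega)
      · omega
    have key : ∀ l : List (Symbol T (g.NT × List T)), g.Expands A l → wordYield l = u →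
        (∀ B v, .nonterminal (B, v) ∈ l → g.Gen Q h B [] v) →
        u.count a ≤ C * K + K ∨ ∀ B v, .nonterminal (B, v) ∈ l → v.count a ≤ 1 := by
      rintro l hA rfl hl
      have hly : ∀ B v, .nonterminal (B, v) ∈ l → g.Yields B γ v :=
        fun B v hB => (hl B v hB).yields fun B v hB => (hQ B v hB).1
      by_cases hl2 : ∃ B v, .nonterminal (B, v) ∈ l ∧ 2 ≤ v.count a
      · obtain ⟨m, h₁, h₂, h₃, h₄⟩ := hA.exists_refine (K := K) (γ := γ) (fun B v hB => by
          obtain ⟨l₁, l₂, rfl⟩ := List.append_of_mem hB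
          have hc' := hc.of_expands hA hly
          have hw' : x ++ wordYield l₁ ++ v ++ (wordYield l₂ ++ y) = w := by
            simpa [letterYield] using hxy
          have hv := ih hQ (hl B v hB) hc' hw'
          refine (hl B v hB).exists_small_cut hL hC hCK hQ hc' ?_
          -- By `hv` at least three `a`s of `w` lie outside `v`, hence two on one side; this is the
          -- source of the `+ 2` in `hw`.
          rw [← hw', List.count_append, List.count_append (l₁ := x ++ wordYield l₁)] at hw
          omega) hl2
        rw [← h₂]
        exact .inl ((count_le_of_expands hL hC hc h₁ hK h₃ (.inr (.inr h₄))).trans (by omega))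
      · push Not at hl2
        exact .inr fun B v hB => Nat.le_of_lt_succ (hl2 B v hB)
    cases H with
    | leaf hQA => exact (hQ A u hQA).2.trans (by omega)
    | rewrite l hr hl =>
      refine (key l (derives_of_rewrite hr []) rfl hl).elim id fun h₁ => ?_
      have h₂ := count_wordYield_le a le_rfl l h₁
      have h₃ := hrw A _ hr
      simp only [skeleton, List.length_map] at h₃
      omega
    | @push _ _ B f _ _ hr hu =>
      obtain ⟨l, hA, hlu, hl, H'⟩ := hu.exists_split_of_push hr
      refine (key l hA hlu hl).elim id fun h₁ => ?_
      -- The pushed index joins the unspecified string, and the leaves of `H'` are the words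
      -- obtained by popping it. Their letters occur in `l` and so yield at most one `a` each; the
      -- rule length bounds the total by `K`.
      refine ih (γ := f :: γ) ?_ H' (fun v hv => hc v ((derives_of_push hr γ).trans hv)) hxy
      rintro D _ ⟨m, hrm, rfl, hm, hml⟩
      constructor
      · exact (derives_of_pop hrm γ).trans (derives_wordYield γ m fun E e hE =>
          (hm E e hE).yields fun B v hB => (hQ B v hB).1)
      · have h₂ := count_wordYield_le a le_rfl m fun E e hE => h₁ E e (hml _ hE)
        have h₃ := hpop D f _ hrm
        simp only [skeleton, List.length_map] at h₃
        omega

/-- The words of a rigid indexed language have boundedly many `a`s. -/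
theorem exists_count_le_of_isRigid (hL : IsRigid a g.language) :
    ∃ M : ℕ, ∀ w ∈ g.language, w.count a ≤ M := by
  obtain ⟨C, hC⟩ := g.exists_bound_expansion
  obtain ⟨c, hrw, hpop⟩ := g.exists_bound_rules
  -- `K` dominates the expansion bound and all rule lengths, and is positive.
  let K := C + c + 1
  refine ⟨C * K + K + 2, fun w hw => ?_⟩
  by_contra! hlt
  obtain ⟨h, m, hm, rfl, hG⟩ := Derives.exists_gen hw
  obtain ⟨s, m, rfl, hs, hm⟩ := List.map_eq_cons_iff.1 hm
  obtain rfl : m = [] := by simpa using hm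
  rcases s with t | ⟨⟨A, σ⟩, v⟩
  · simp [eraseLetter] at hs
  obtain ⟨rfl, rfl⟩ : A = g.initial ∧ σ = [] := by simpa [eraseLetter] using hs
  have := (hG g.initial [] v (by simp)).count_le (K := K) (γ := []) (x := []) (y := []) hL hC
    (by omega) (by omega) (fun A α h => (hrw A α h).trans (by omega))
    (fun A f α h => (hpop A f α h).trans (by omega)) hlt (by simp)
    (fun v hv => by simpa using! hv) (by simp [letterYield])
  simp only [wordYield_cons, letterYield, wordYield_nil, List.append_nil] at hlt
  omega

end Rigid

end IndexedGrammar

/-! ### Rigidity of the language of the words (ab^n)^n -/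

theorem List.append_cons_inj_of_not_mem_of_not_mem {T : Type*} {a : T} {s t l m : List T}
    (hs : a ∉ s) (ht : a ∉ t) (h : s ++ a :: l = t ++ a :: m) : s = t := by
  induction s generalizing t with
  | nil =>
    cases t with
    | nil => rfl
    | cons c t => simp_all
  | cons c s ih =>
    cases t with
    | nil => simp_all
    | cons d t =>
      simp only [List.cons_append, List.cons.injEq, List.mem_cons, not_or] at h hs ht
      rw [h.1, ih hs.2 ht.2 h.2]

theorem List.exists_infix_of_two_le_count {T : Type*} [DecidableEq T] {a : T} {s : List T}
    (h : 2 ≤ s.count a) : ∃ t, a ∉ t ∧ a :: t ++ [a] <:+: s := by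
  obtain ⟨s₁, s₂, rfl, h₁⟩ := List.eq_append_cons_of_mem (a := a) (xs := s)
    (List.count_pos_iff.1 (by omega))
  have h₂ : 0 < s₂.count a := by
    rw [List.count_append, List.count_eq_zero_of_not_mem h₁, List.count_cons_self] at h
    omega
  obtain ⟨t, s₃, rfl, ht⟩ := List.eq_append_cons_of_mem (List.count_pos_iff.1 h₂)
  exact ⟨t, ht, s₁, s₃, by simp⟩

/-- Blocks are stripped from the left until the factor starts at a block; its closing `a` must then
open the next block. The number `k` of blocks is kept apart from `n` for the induction. -/
theorem eq_replicate_of_infix_flatten {T : Type*} {a b : T} (hab : a ≠ b) {t : List T}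
    (ht : a ∉ t) (n k : ℕ)
    (h : a :: t ++ [a] <:+: (List.replicate k (a :: List.replicate n b)).flatten) :
    t = List.replicate n b := by
  obtain ⟨l₁, l₂, h⟩ := h
  have hb : a ∉ List.replicate n b := by simp [List.mem_replicate, hab]
  induction k generalizing l₁ with
  | zero => simp at h
  | succ k ih =>
    rw [List.replicate_succ, List.flatten_cons] at h
    cases l₁ with
    | nil =>
      simp only [List.nil_append, List.cons_append, List.append_assoc, List.cons.injEq,
        true_and] at h
      cases k with
      | zero =>
        simp only [List.replicate_zero, List.flatten_nil, List.append_nil] at h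
        exact (hb (h ▸ by simp)).elim
      | succ k =>
        rw [List.replicate_succ, List.flatten_cons] at h
        exact List.append_cons_inj_of_not_mem_of_not_mem ht hb h
    | cons c l₁ =>
      simp only [List.cons_append, List.append_assoc, List.cons.injEq] at h
      obtain ⟨-, h⟩ := h
      obtain ⟨m, hm, hm'⟩ | ⟨m, hm, hm'⟩ := List.append_eq_append_iff.1 h
      · cases m with
        | nil => exact ih [] (by simpa using hm')
        -- Here the first `a` of the factor would fall inside a run of `b`s.
        | cons d m =>
          simp only [List.cons_append, List.cons.injEq] at hm'
          exact (hb (hm ▸ by simp [hm'.1])).elim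
      · exact ih m (by simpa using hm'.symm)

theorem isRigid_abPowLanguage {T : Type*} [DecidableEq T] {a b : T} (hab : a ≠ b) :
    IndexedGrammar.IsRigid a (abPowLanguage a b) := by
  rintro _ ⟨n, -, rfl⟩ _ ⟨n', -, rfl⟩ s hs hs' h
  obtain ⟨t, ht, hts⟩ := List.exists_infix_of_two_le_count h
  have h₁ := eq_replicate_of_infix_flatten hab ht n n (hts.trans hs)
  have h₂ := eq_replicate_of_infix_flatten hab ht n' n' (hts.trans hs')
  have : n = n' := by simpa using congrArg List.length (h₁.symm.trans h₂)
  rw [this]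

theorem count_abPowWord {T : Type*} [DecidableEq T] {a b : T} (hab : a ≠ b) (n : ℕ) :
    (abPowWord a b n).count a = n := by
  simp [abPowWord, List.count_flatten, List.count_replicate, hab.symm]

theorem corollary4 {T : Type*} [Finite T] (a b : T) (hab : a ≠ b) :
    ¬ (abPowLanguage a b).IsIndexed := by
  classical
  rintro ⟨g, hg⟩
  obtain ⟨M, hM⟩ := IndexedGrammar.exists_count_le_of_isRigid (g := g) (a := a)
    (hg ▸ isRigid_abPowLanguage hab)
  have := hM (abPowWord a b (M + 1)) (hg ▸ ⟨M + 1, by omega, rfl⟩)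
  rw [count_abPowWord hab] at this
  omega
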